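/- Let $\mathbb D$ be the open unit disk, $\mathbb T$ the unit circle and $m$ the normalized Lebesgue measure on $\mathbb T$. The disk algebra $A(\mathbb D)$ consists of the functions continuous on $\overline{\mathbb D}$ and analytic in $\mathbb D$, and $H^\infty$ is the weak*-closure of $A(\mathbb D)$ (through boundary values) in $L^\infty(m)=L^1(m)^*$, with the norm and the weak* topology of $L^\infty(m)$; an element $h\in H^\infty$ is identified with the bounded analytic function $h(z)=\int_{\mathbb T}\frac{1-|z|^2}{|w-z|^2}\,h(w)\,dm(w)$ on $\mathbb D$. The space $\ell^\infty=(\ell^1)^*$ of bounded complex sequences $c=(c_n)_{n\in\mathbb N}$ carries its sup norm and its weak* topology. **Theorem.** Let $(\Gamma_n)_{n\in\mathbb N}$ be open subarcs of $\mathbb T$ whose closures are pairwise disjoint, let $a_n\in\Gamma_n$, and let $\varepsilon,\delta_n>0$ satisfy $\sum_{n}\delta_n<\varepsilon<1$. Let $g_n\in A(\mathbb D)$ be such that, for each $n$, $g_n(a_n)=1$, $|g_n|<1$ on $\mathbb T\setminus\{a_n\}$ and $|g_n|<\delta_n$ on $\mathbb T\setminus\Gamma_n$. Then for every $c\in\ell^\infty$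 the series $$T(c)=\sum_{n}c_n g_n$$ converges weak* in $H^\infty$, and $T(c)(z)=\sum_n c_n g_n(z)$ for every $z\in\mathbb D$. The linear map $T$ so defined is a bijection of $\ell^\infty$ onto a weak*-closed subspace $\mathcal E=T(\ell^\infty)$ of $H^\infty$, and $T:\ell^\infty\to\mathcal E$ is a homeomorphism both for the weak* topologies and for the norm topologies, with $$\|T\|\le 1+\varepsilon,\qquad \|T^{-1}\|\le(1-\varepsilon)^{-1}.$$ -/

import Mathlib

open MeasureTheory Topology
open scoped ENNReal

noncomputable section

/-- The unit circle carries its Borel σ-algebra. -/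
instance Circle.instMeasurableSpace : MeasurableSpace Circle := borel Circle

instance Circle.instBorelSpace : BorelSpace Circle := ⟨rfl⟩

/-- Normalized Lebesgue measure `m` on the unit circle:
`∫ f dm = (1 / 2π) ∫_0^{2π} f (e^{it}) dt`. -/
def circleMeasure : Measure Circle :=
  ENNReal.ofReal (2 * Real.pi)⁻¹ •
    (volume.restrict (Set.Ioc 0 (2 * Real.pi))).map Circle.exp

/-- Open subarcs of the circle with distinct endpoints `e^{iα}`, `e^{iβ}`. -/
def IsOpenArc (Γ : Set Circle) : Prop :=
  ∃ α β : ℝ, α < β ∧ β < α + 2 * Real.pi ∧ Γ = Circle.exp '' Set.Ioo α β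

/-- `L^1(m)`. -/
abbrev LOne : Type := Lp ℂ 1 circleMeasure

/-- `L^∞(m)`. -/
abbrev LInf : Type := Lp ℂ ∞ circleMeasure

/-- `ℓ^1`. -/
abbrev EllOne : Type := lp (fun _ : ℕ => ℂ) 1

/-- `ℓ^∞`. -/
abbrev EllInf : Type := lp (fun _ : ℕ => ℂ) ∞

/-- The duality `(h, f) ↦ ∫ h f dm` between `L^∞` and `L^1`. -/
def pairL : LInf →ₗ[ℂ] LOne →ₗ[ℂ] ℂ :=
  ((ContinuousLinearMap.mul ℂ ℂ).lpPairing circleMeasure ∞ 1).toLinearMap₁₂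

theorem pairL_apply (h : LInf) (f : LOne) :
    pairL h f = ∫ w, h w * f w ∂circleMeasure :=
  (ContinuousLinearMap.mul ℂ ℂ).lpPairing_eq_integral h f

/-- The duality `(c, x) ↦ ∑ c_n x_n` between `ℓ^∞` and `ℓ^1`. -/
def pairEll : EllInf →ₗ[ℂ] EllOne →ₗ[ℂ] ℂ :=
  (lp.dualPairing ∞ 1 (fun _ : ℕ => ContinuousLinearMap.mul ℂ ℂ) (K := 1)
    (fun _ => ContinuousLinearMap.opNorm_mul_le ℂ ℂ)).toLinearMap₁₂

theorem pairEll_apply (c : EllInf) (x : EllOne) : pairEll c x = ∑' n, c n * x n := rfl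

/-- The weak* topology of `L^∞ = (L^1)^*`. -/
abbrev weakStarLInf : TopologicalSpace LInf :=
  WeakBilin.instTopologicalSpace pairL

/-- The weak* topology of `ℓ^∞ = (ℓ^1)^*`. -/
abbrev weakStarEllInf : TopologicalSpace EllInf :=
  WeakBilin.instTopologicalSpace pairEll

/-- The disk algebra: functions continuous on the closed unit disk and analytic in the open unit
disk. Only the values on the closed disk matter. -/
def InDiskAlgebra (g : ℂ → ℂ) : Prop := DiffContOnCl ℂ g (Metric.ball 0 1)

theorem InDiskAlgebra.continuous_circle {g : ℂ → ℂ} (hg : InDiskAlgebra g) :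
    Continuous fun w : Circle => g w := by
  have h := hg.continuousOn
  rw [closure_ball (0 : ℂ) one_ne_zero] at h
  exact h.comp_continuous continuous_subtype_val (fun w => by
    rw [mem_closedBall_zero_iff]; exact w.norm_coe.le)

theorem InDiskAlgebra.memLp {g : ℂ → ℂ} (hg : InDiskAlgebra g) :
    MemLp (fun w : Circle => g w) ∞ circleMeasure := by
  obtain ⟨C, hC⟩ := isCompact_univ.exists_bound_of_continuousOn
    hg.continuous_circle.continuousOn
  exact memLp_top_of_bound hg.continuous_circle.aestronglyMeasurable C
    (Filter.Eventually.of_forall fun w => hC w trivial)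

/-- The disk algebra inside `L^∞(m)`, through boundary values. -/
def diskAlgebraTrace : Submodule ℂ LInf where
  carrier := {h | ∃ g : ℂ → ℂ, ∃ hg : InDiskAlgebra g, h = hg.memLp.toLp}
  zero_mem' := ⟨fun _ => 0, diffContOnCl_const, rfl⟩
  add_mem' := by
    rintro _ _ ⟨g₁, h₁, rfl⟩ ⟨g₂, h₂, rfl⟩
    exact ⟨g₁ + g₂, DiffContOnCl.add h₁ h₂, rfl⟩
  smul_mem' := by
    rintro a _ ⟨g, h, rfl⟩
    exact ⟨a • g, DiffContOnCl.const_smul h a, rfl⟩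

theorem weakStarLInf_continuousAdd : @ContinuousAdd LInf weakStarLInf _ :=
  WeakBilin.instContinuousAdd pairL

theorem weakStarLInf_continuousSMul : @ContinuousSMul ℂ LInf _ _ weakStarLInf :=
  WeakBilin.instContinuousSMul pairL

/-- `H^∞`: the weak*-closure of the disk algebra in `L^∞(m)`, with the norm of `L^∞(m)`. -/
def HInf : Submodule ℂ LInf :=
  letI := weakStarLInf
  haveI := weakStarLInf_continuousAdd
  haveI := weakStarLInf_continuousSMul
  diskAlgebraTrace.topologicalClosure

theorem coe_HInf : (HInf : Set LInf) = @closure LInf weakStarLInf diskAlgebraTrace := rfl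

/-- The weak* topology of `H^∞ = (L^1 / H^1_0)^*`, that is the topology of the duality
`⟨[f], h⟩ = ∫ f h dm`, `f ∈ L^1`. -/
abbrev weakStarHInf : TopologicalSpace HInf :=
  TopologicalSpace.induced Subtype.val weakStarLInf

/-- The weak* topology on a subspace of `H^∞`. -/
abbrev weakStarSub (E : Submodule ℂ HInf) : TopologicalSpace E :=
  TopologicalSpace.induced Subtype.val weakStarHInf

/-- A function of the disk algebra as an element of `H^∞`. -/
def InDiskAlgebra.toHInf {g : ℂ → ℂ} (hg : InDiskAlgebra g) : HInf :=
  ⟨hg.memLp.toLp, @subset_closure LInf weakStarLInf _ _ ⟨g, hg, rfl⟩⟩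

/-- The value at the point `z` of the open unit disk of `h ∈ H^∞`, seen as a bounded analytic
function in the disk: the integral of `h` against the Poisson kernel
`w ↦ (1 - |z|²) / |w - z|²`. -/
def HInf.eval (h : HInf) (z : ℂ) : ℂ :=
  ∫ w : Circle, (poissonKernel 0 z w : ℂ) * (h : LInf) w ∂circleMeasure

end

/-! `T` is the adjoint of `S : L^1 → ℓ^1`, `S f = (∫ g_n f dm)_n`, so everything follows from a
bounded right inverse of `S`. A point of the circle lies in at most one arc, hence `∑ |g_n| ≤ 1 + ε`
there (`sum_norm_le_one_add`), which bounds `S` and `T`.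

Averaging over a small neighbourhood of `a_n` gives a unit vector `v_n` of `L^1` with `‖S v_n - e_n‖
≤ ∑ δ_k < ε` (`exists_LOne_peak`). If `R : ℓ^1 → L^1` sends `e_n` to `v_n`, then `S R` is within `ε`
of the identity, because norms of operators on `ℓ^1` are read off the unit vectors. A Neumann series
(`EllOne.exists_rightInverse`) yields `Q` with `S R Q = 1` and `‖R Q‖ ≤ (1 - ε)⁻¹`.

The adjoint of `R Q` is then a left inverse of `T`, continuous for both the norm and the weak*
topologies. This gives both homeomorphisms, the bound on the inverse, and the closed range. -/

/-! ### Operators on `ℓ^1` and the dual of `ℓ^1` -/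

theorem EllOne.hasSum_norm (x : EllOne) : HasSum (fun n => ‖x n‖) ‖x‖ := by
  simpa using lp.hasSum_norm (p := 1) (by simp) x

theorem EllOne.hasSum_smul_single (x : EllOne) :
    HasSum (fun n => x n • (lp.single 1 n 1 : EllOne)) x := by
  have h := lp.hasSum_single (p := 1) ENNReal.one_ne_top x
  refine h.congr_fun ?_
  intro n
  rw [← lp.single_smul, smul_eq_mul, mul_one]

section

variable {X : Type*} [NormedAddCommGroup X] [NormedSpace ℂ X]

theorem EllOne.hasSum_map (L : EllOne →L[ℂ] X) (x : EllOne) :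
    HasSum (fun n => x n • L (lp.single 1 n 1)) (L x) := by
  simpa using L.hasSum (EllOne.hasSum_smul_single x)

/-- Every `x` is an absolutely convergent combination of unit vectors with total weight `‖x‖`, so a
bound on the unit vectors suffices. -/
theorem EllOne.norm_map_le (L : EllOne →L[ℂ] X) {C : ℝ}
    (hL : ∀ n, ‖L (lp.single 1 n 1)‖ ≤ C) (x : EllOne) : ‖L x‖ ≤ C * ‖x‖ := by
  have h := (EllOne.hasSum_norm x).mul_left C
  refine (EllOne.hasSum_map L x).norm_le_of_bounded h fun n => ?_
  rw [norm_smul, mul_comm]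
  gcongr
  exact hL n

theorem EllOne.exists_map_single_eq [CompleteSpace X] (v : ℕ → X) {C : ℝ}
    (hv : ∀ n, ‖v n‖ ≤ C) :
    ∃ L : EllOne →L[ℂ] X, ∀ n, L (lp.single 1 n 1) = v n := by
  have hb : ∀ (x : EllOne) (n : ℕ), ‖x n • v n‖ ≤ C * ‖x n‖ := fun x n => by
    rw [norm_smul, mul_comm]
    gcongr
    exact hv n
  have hs : ∀ x : EllOne, Summable fun n => x n • v n := fun x =>
    .of_norm_bounded ((EllOne.hasSum_norm x).summable.mul_left C) (hb x)
  let L₀ : EllOne →ₗ[ℂ] X :=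
    { toFun := fun x => ∑' n, x n • v n
      map_add' := fun x y => by
        rw [← (hs x).tsum_add (hs y)]
        exact tsum_congr fun n => by simp [add_smul]
      map_smul' := fun a x => by
        rw [RingHom.id_apply, ← (hs x).tsum_const_smul a]
        exact tsum_congr fun n => by simp [mul_smul] }
  refine ⟨L₀.mkContinuous C fun x => ?_, fun n => ?_⟩
  · exact (hs x).hasSum.norm_le_of_bounded ((EllOne.hasSum_norm x).mul_left C) (hb x)
  · change ∑' k, (lp.single 1 n 1 : EllOne) k • v k = v n
    rw [tsum_eq_single n]
    · rw [lp.single_apply_self, one_smul]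
    · intro k hk
      rw [lp.single_apply_ne _ _ _ hk, zero_smul]

/-- A bounded operator on `ℓ^1` that moves each unit vector by at most `ε < 1` has a right
inverse, of norm at most `(1 - ε)⁻¹`. -/
theorem EllOne.exists_rightInverse (A : EllOne →L[ℂ] EllOne) {ε : ℝ} (hε0 : 0 ≤ ε) (hε : ε < 1)
    (hA : ∀ n, ‖A (lp.single 1 n 1) - lp.single 1 n 1‖ ≤ ε) :
    ∃ Q : EllOne →L[ℂ] EllOne, (∀ x, A (Q x) = x) ∧ ∀ x, ‖Q x‖ ≤ (1 - ε)⁻¹ * ‖x‖ := by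
  set K : EllOne →L[ℂ] EllOne := 1 - A with hK
  have hKx : ∀ x, ‖K x‖ ≤ ε * ‖x‖ := EllOne.norm_map_le K fun n => by
    rw [hK, sub_apply, one_apply_eq_self, norm_sub_rev]
    exact hA n
  have hKn : ‖K‖ < 1 := (K.opNorm_le_bound hε0 hKx).trans_lt hε
  let U := Units.oneSub K hKn
  have hU : (U : EllOne →L[ℂ] EllOne) = A := by simp [U, hK]
  have hQ : ∀ x, A ((↑U⁻¹ : EllOne →L[ℂ] EllOne) x) = x := fun x => by
    rw [← hU, ← mul_apply_eq_comp, Units.mul_inv, one_apply_eq_self]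
  refine ⟨↑U⁻¹, hQ, fun x => ?_⟩
  set y := (↑U⁻¹ : EllOne →L[ℂ] EllOne) x
  -- Bounding `y` through this fixed-point equation replaces summing the Neumann series.
  have h1 : y = x + K y := by
    rw [hK, sub_apply, one_apply_eq_self, hQ x]
    abel
  have h2 : ‖y‖ ≤ ‖x‖ + ε * ‖y‖ := by
    calc ‖y‖ = ‖x + K y‖ := by rw [← h1]
      _ ≤ ‖x‖ + ‖K y‖ := norm_add_le _ _
      _ ≤ _ := by gcongr; exact hKx y
  rw [inv_mul_eq_div, le_div_iff₀ (by linarith)]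
  linarith

end

theorem hasSum_pairEll (c : EllInf) (x : EllOne) :
    HasSum (fun n => c n * x n) (pairEll c x) := by
  rw [pairEll_apply]
  refine Summable.hasSum (.of_norm_bounded ((EllOne.hasSum_norm x).summable.mul_left ‖c‖) ?_)
  intro n
  rw [norm_mul]
  gcongr
  exact lp.norm_apply_le_norm (by simp) c n

/-- `ℓ^∞` is the dual of `ℓ^1`. -/
theorem EllInf.exists_pairEll_eq (φ : EllOne →L[ℂ] ℂ) {C : ℝ} (hC : 0 ≤ C)
    (hφ : ∀ x, ‖φ x‖ ≤ C * ‖x‖) :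
    ∃ c : EllInf, (∀ x, pairEll c x = φ x) ∧ ‖c‖ ≤ C := by
  have hb : ∀ n, ‖φ (lp.single 1 n 1)‖ ≤ C := fun n => by
    simpa using hφ (lp.single 1 n 1)
  let c : EllInf := ⟨fun n => φ (lp.single 1 n 1), memℓp_infty ⟨C, by
    rintro _ ⟨n, rfl⟩; exact hb n⟩⟩
  refine ⟨c, fun x => ?_, lp.norm_le_of_forall_le hC hb⟩
  refine (hasSum_pairEll c x).unique ((EllOne.hasSum_map φ x).congr_fun fun n => ?_)
  exact mul_comm _ _

theorem pairEll_injective : Function.Injective pairEll := by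
  refine (injective_iff_map_eq_zero _).2 fun c hc => ?_
  ext n
  have h := hasSum_pairEll c (lp.single 1 n 1)
  rw [hc, LinearMap.zero_apply] at h
  have h' := (hasSum_single n fun k hk => by
    rw [lp.single_apply_ne _ _ _ hk, mul_zero]).unique h
  simpa using h'

/-! ### The measure on the circle and the Poisson integral -/

theorem integral_circleMeasure {f : Circle → ℂ} (hf : Continuous f) :
    ∫ w, f w ∂circleMeasure =
      (2 * Real.pi)⁻¹ • ∫ t in (0 : ℝ)..2 * Real.pi, f (Circle.exp t) := by
  rw [circleMeasure, integral_smul_measure,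
    ENNReal.toReal_ofReal (inv_nonneg.2 Real.two_pi_pos.le),
    integral_map Circle.exp.continuous.aemeasurable hf.aestronglyMeasurable,
    intervalIntegral.integral_of_le Real.two_pi_pos.le]

instance circleMeasure.instIsFiniteMeasure : IsFiniteMeasure circleMeasure := by
  rw [circleMeasure]
  have : IsFiniteMeasure ((volume.restrict (Set.Ioc 0 (2 * Real.pi))).map Circle.exp) :=
    inferInstance
  exact Measure.smul_finite _ ENNReal.ofReal_ne_top

instance circleMeasure.instIsOpenPosMeasure : circleMeasure.IsOpenPosMeasure where
  open_pos V hV := by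
    rintro ⟨w, hw⟩ h0
    have hVm : MeasurableSet V := hV.measurableSet
    rw [circleMeasure, Measure.smul_apply, smul_eq_mul, mul_eq_zero, ENNReal.ofReal_eq_zero] at h0
    have h1 := h0.resolve_left (not_le.2 (inv_pos.2 Real.two_pi_pos))
    have hpre : IsOpen (Circle.exp ⁻¹' V) := hV.preimage Circle.exp.continuous
    rw [Measure.map_apply Circle.exp.continuous.measurable hVm,
      Measure.restrict_apply hpre.measurableSet] at h1
    obtain ⟨t, ht, rfl⟩ : ∃ t ∈ Set.Ioc 0 (2 * Real.pi), Circle.exp t = w := by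
      obtain ⟨s, rfl⟩ := Circle.exp_surjective w
      obtain ⟨t, ht, hst⟩ := Circle.periodic_exp.exists_mem_Ioc Real.two_pi_pos s 0
      exact ⟨t, by simpa using ht, hst.symm⟩
    -- `t` may be the endpoint `2π`, so the preimage of `V` has to be met with the open interval.
    have hcl : t ∈ closure (Set.Ioo 0 (2 * Real.pi)) := by
      rw [closure_Ioo Real.two_pi_pos.ne]
      exact ⟨ht.1.le, ht.2⟩
    have hne := mem_closure_iff.1 hcl _ hpre hw
    refine ((hpre.inter isOpen_Ioo).measure_pos volume hne).ne' (measure_mono_null ?_ h1)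
    exact Set.inter_subset_inter_right _ Set.Ioo_subset_Ioc_self

theorem IsOpenArc.isOpen {Γ : Set Circle} (h : IsOpenArc Γ) : IsOpen Γ := by
  obtain ⟨α, β, -, -, rfl⟩ := h
  exact isLocalHomeomorph_circleExp.isOpenMap _ isOpen_Ioo

theorem continuous_poissonKernel_circle {z : ℂ} (hz : z ∈ Metric.ball (0 : ℂ) 1) :
    Continuous fun w : Circle => (poissonKernel 0 z w : ℂ) := by
  refine Complex.continuous_ofReal.comp ?_
  simp only [poissonKernel_def, sub_zero]
  refine Continuous.div (by fun_prop) (by fun_prop) fun w => ?_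
  have hne : (w : ℂ) - z ≠ 0 := by
    rw [sub_ne_zero]
    rintro rfl
    simp [w.norm_coe] at hz
  positivity

/-- The Poisson integral formula for functions of the disk algebra. -/
theorem InDiskAlgebra.integral_poissonKernel {g : ℂ → ℂ} (hg : InDiskAlgebra g) {z : ℂ}
    (hz : z ∈ Metric.ball (0 : ℂ) 1) :
    ∫ w : Circle, (poissonKernel 0 z w : ℂ) * g w ∂circleMeasure = g z := by
  have hc : Continuous fun w : Circle => (poissonKernel 0 z w : ℂ) * g w :=
    (continuous_poissonKernel_circle hz).mul hg.continuous_circle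
  rw [integral_circleMeasure hc, ← DiffContOnCl.circleAverage_poissonKernel_smul hg hz, Real.circleAverage_def]
  simp [circleMap]

/-- The Poisson kernel as an element of `L^1`. -/
theorem exists_pairL_eq_eval {z : ℂ} (hz : z ∈ Metric.ball (0 : ℂ) 1) :
    ∃ p : LOne, (∀ h : HInf, HInf.eval h z = pairL h p) ∧
      ∀ (g : ℂ → ℂ) (hg : InDiskAlgebra g), pairL hg.toHInf p = g z := by
  have hc := continuous_poissonKernel_circle hz
  have hp : MemLp (fun w : Circle => (poissonKernel 0 z w : ℂ)) 1 circleMeasure := by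
    obtain ⟨C, hC⟩ := isCompact_univ.exists_bound_of_continuousOn hc.continuousOn
    exact .of_bound hc.aestronglyMeasurable C (.of_forall fun w => hC w trivial)
  have heval : ∀ h : HInf, HInf.eval h z = pairL h hp.toLp := fun h => by
    rw [HInf.eval, pairL_apply]
    refine integral_congr_ae ?_
    filter_upwards [hp.coeFn_toLp] with w hw
    rw [hw, mul_comm]
  refine ⟨hp.toLp, heval, fun g hg => ?_⟩
  rw [← heval, ← hg.integral_poissonKernel hz, HInf.eval]
  refine integral_congr_ae ?_
  filter_upwards [hg.memLp.coeFn_toLp] with w hw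
  congr 1

/-! ### The pairing of `L^∞` with `L^1` -/

theorem LInf.ae_norm_le_norm (h : LInf) : ∀ᵐ w ∂circleMeasure, ‖h w‖ ≤ ‖h‖ := by
  filter_upwards [ae_le_eLpNormEssSup (f := h) (μ := circleMeasure)] with w hw
  rw [Lp.norm_def, eLpNorm_exponent_top, ← toReal_enorm]
  refine ENNReal.toReal_mono ?_ hw
  rw [← eLpNorm_exponent_top]
  exact (Lp.memLp h).eLpNorm_ne_top

theorem norm_pairL_le (h : LInf) (f : LOne) : ‖pairL h f‖ ≤ ‖h‖ * ‖f‖ := by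
  rw [pairL_apply, L1.norm_eq_integral_norm, ← integral_const_mul]
  refine norm_integral_le_of_norm_le ((L1.integrable_coeFn f).norm.const_mul _) ?_
  filter_upwards [LInf.ae_norm_le_norm h] with w hw
  rw [norm_mul]
  gcongr

theorem pairL_injective : Function.Injective pairL := by
  refine (injective_iff_map_eq_zero _).2 fun h hh => ?_
  rw [Lp.eq_zero_iff_ae_eq_zero]
  have hi : Integrable h circleMeasure := (Lp.memLp h).integrable le_top
  refine hi.ae_eq_zero_of_forall_setIntegral_eq_zero fun s hs _ => ?_
  have h1 := LinearMap.congr_fun hh (indicatorConstLp 1 hs (measure_ne_top _ _) (1 : ℂ))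
  rw [pairL_apply, LinearMap.zero_apply] at h1
  rw [← h1, ← integral_indicator hs]
  refine integral_congr_ae ?_
  filter_upwards [indicatorConstLp_coeFn (p := 1) (hs := hs) (hμs := measure_ne_top circleMeasure s)
    (c := (1 : ℂ))] with w hw
  rw [hw]
  by_cases hws : w ∈ s <;> simp [hws]

/-- The normalized indicator function of a set of positive measure. -/
theorem exists_LOne_average {U : Set Circle} (hU : MeasurableSet U) (hU0 : circleMeasure U ≠ 0) :
    ∃ f : LOne, ‖f‖ = 1 ∧ ∀ (g : Circle → ℂ) (h : LInf), h =ᵐ[circleMeasure] g →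
      pairL h f = ⨍ w in U, g w ∂circleMeasure := by
  have hpos : 0 < circleMeasure.real U := ENNReal.toReal_pos hU0 (measure_ne_top _ _)
  refine ⟨indicatorConstLp 1 hU (measure_ne_top _ _) (((circleMeasure.real U)⁻¹ : ℝ) : ℂ), ?_,
    fun g h hgh => ?_⟩
  · rw [norm_indicatorConstLp one_ne_zero ENNReal.one_ne_top]
    simp [abs_of_pos hpos, hpos.ne']
  · rw [pairL_apply, setAverage_eq, ← integral_indicator hU, ← integral_smul]
    refine integral_congr_ae ?_
    filter_upwards [hgh, indicatorConstLp_coeFn (p := 1) (hs := hU)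
      (hμs := measure_ne_top circleMeasure U) (c := (((circleMeasure.real U)⁻¹ : ℝ) : ℂ))]
      with w hw1 hw2
    rw [hw1, hw2]
    by_cases hws : w ∈ U <;> simp [hws, mul_comm]

/-! ### The operator `S` and its adjoint -/

section

variable {g : ℕ → ℂ → ℂ} {B : ℝ}

theorem LOne.integrable_mul {g : ℂ → ℂ} (hg : InDiskAlgebra g) (f : LOne) :
    Integrable (fun w : Circle => g w * f w) circleMeasure := by
  obtain ⟨C, hC⟩ := isCompact_univ.exists_bound_of_continuousOn hg.continuous_circle.continuousOn
  exact (L1.integrable_coeFn f).bdd_mul hg.continuous_circle.aestronglyMeasurable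
    (.of_forall fun w => hC w trivial)

theorem InDiskAlgebra.pairL_toLp {g : ℂ → ℂ} (hg : InDiskAlgebra g) (f : LOne) :
    pairL hg.memLp.toLp f = ∫ w : Circle, g w * f w ∂circleMeasure := by
  rw [pairL_apply]
  refine integral_congr_ae ?_
  filter_upwards [hg.memLp.coeFn_toLp] with w hw
  rw [hw]

theorem sum_integral_norm_mul_le (hg : ∀ n, InDiskAlgebra (g n))
    (hB : ∀ (w : Circle) (s : Finset ℕ), ∑ n ∈ s, ‖g n w‖ ≤ B) (f : LOne) (s : Finset ℕ) :
    ∑ n ∈ s, ∫ w : Circle, ‖g n w * f w‖ ∂circleMeasure ≤ B * ‖f‖ := by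
  have hi := fun n => (LOne.integrable_mul (hg n) f).norm
  rw [← integral_finsetSum s fun n _ => hi n, L1.norm_eq_integral_norm, ← integral_const_mul]
  refine integral_mono (integrable_finsetSum s fun n _ => hi n)
    ((L1.integrable_coeFn f).norm.const_mul _) fun w => ?_
  simp only [norm_mul]
  rw [← Finset.sum_mul]
  gcongr
  exact hB w s

/-- The operator `f ↦ (∫ g_n f dm)_n` from `L^1` to `ℓ^1`. -/
theorem exists_analysis (hg : ∀ n, InDiskAlgebra (g n))
    (hB : ∀ (w : Circle) (s : Finset ℕ), ∑ n ∈ s, ‖g n w‖ ≤ B) :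
    ∃ S : LOne →L[ℂ] EllOne, ∀ f n, S f n = pairL (hg n).memLp.toLp f := by
  have hsum : ∀ (f : LOne) (s : Finset ℕ),
      ∑ n ∈ s, ‖pairL (hg n).memLp.toLp f‖ ≤ B * ‖f‖ := fun f s => by
    refine (Finset.sum_le_sum fun n _ => ?_).trans (sum_integral_norm_mul_le hg hB f s)
    rw [(hg n).pairL_toLp]
    exact norm_integral_le_integral_norm _
  have hmem : ∀ f : LOne, Memℓp (fun n => pairL (hg n).memLp.toLp f) 1 := fun f => by
    refine memℓp_gen ?_
    simpa using summable_of_sum_le (fun n => norm_nonneg _) (hsum f)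
  let S₀ : LOne →ₗ[ℂ] EllOne :=
    { toFun := fun f => ⟨fun n => pairL (hg n).memLp.toLp f, hmem f⟩
      map_add' := fun f f' => by ext n; exact map_add _ _ _
      map_smul' := fun a f => by ext n; exact map_smul _ _ _ }
  refine ⟨S₀.mkContinuous B fun f => ?_, fun f n => rfl⟩
  exact hasSum_le_of_sum_le (EllOne.hasSum_norm (S₀ f)) (hsum f)

/-- The operator `c ↦ ∑ c_n g_n`, as the adjoint of `f ↦ (∫ g_n f dm)_n`. -/
theorem exists_synthesis (hg : ∀ n, InDiskAlgebra (g n)) (hB0 : 0 ≤ B)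
    (hB : ∀ (w : Circle) (s : Finset ℕ), ∑ n ∈ s, ‖g n w‖ ≤ B)
    (S : LOne →L[ℂ] EllOne) (hS : ∀ f n, S f n = pairL (hg n).memLp.toLp f) (c : EllInf) :
    ∃ h : LInf, ‖h‖ ≤ B * ‖c‖ ∧ ∀ f, pairL h f = pairEll c (S f) := by
  have hc : ∀ n, ‖c n‖ ≤ ‖c‖ := lp.norm_apply_le_norm (by simp) c
  have hfin : ∀ (w : Circle) (s : Finset ℕ), ∑ n ∈ s, ‖c n * g n w‖ ≤ B * ‖c‖ := fun w s => by
    calc ∑ n ∈ s, ‖c n * g n w‖ ≤ ∑ n ∈ s, ‖c‖ * ‖g n w‖ :=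
          Finset.sum_le_sum fun n _ => by rw [norm_mul]; gcongr; exact hc n
      _ = ‖c‖ * ∑ n ∈ s, ‖g n w‖ := (Finset.mul_sum ..).symm
      _ ≤ ‖c‖ * B := by gcongr; exact hB w s
      _ = _ := mul_comm _ _
  have hs : ∀ w : Circle, Summable fun n => c n * g n w := fun w =>
    .of_norm (summable_of_sum_le (fun n => norm_nonneg _) (hfin w))
  -- The series converges absolutely at every point of the circle, so its pointwise sum represents
  -- the required class.
  set G : Circle → ℂ := fun w => ∑' n, c n * g n w with hG
  have hGb : ∀ w, ‖G w‖ ≤ B * ‖c‖ := fun w =>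
    (norm_tsum_le_tsum_norm (hs w).norm).trans ((hs w).norm.tsum_le_of_sum_le (hfin w))
  have hGm : StronglyMeasurable G := by
    refine stronglyMeasurable_of_tendsto (f := fun (N : ℕ) (w : Circle) =>
      ∑ n ∈ Finset.range N, c n * g n w) Filter.atTop (fun N => ?_) ?_
    · refine Continuous.stronglyMeasurable (continuous_finsetSum _ fun n _ => ?_)
      exact continuous_const.mul (hg n).continuous_circle
    · exact tendsto_pi_nhds.2 fun w => (hs w).hasSum.tendsto_sum_nat
  have hGL : MemLp G ∞ circleMeasure :=
    memLp_top_of_bound hGm.aestronglyMeasurable _ (.of_forall hGb)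
  have hC : 0 ≤ B * ‖c‖ := by positivity
  refine ⟨hGL.toLp, ?_, fun f => ?_⟩
  · have := Lp.norm_le_of_ae_bound (f := hGL.toLp) hC (by
      filter_upwards [hGL.coeFn_toLp] with w hw
      rw [hw]
      exact hGb w)
    simpa using this
  · have hi : ∀ n, Integrable (fun w : Circle => c n * (g n w * f w)) circleMeasure := fun n =>
      (LOne.integrable_mul (hg n) f).const_mul _
    have hsum : Summable fun n => ∫ w : Circle, ‖c n * (g n w * f w)‖ ∂circleMeasure := by
      have h1 : Summable fun n => ∫ w : Circle, ‖g n w * f w‖ ∂circleMeasure :=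
        summable_of_sum_le
          (fun n => integral_nonneg (μ := circleMeasure) fun w : Circle => norm_nonneg (g n w * f w))
          (sum_integral_norm_mul_le hg hB f)
      refine .of_nonneg_of_le (fun n => integral_nonneg fun w => norm_nonneg _) (fun n => ?_)
        (h1.mul_left ‖c‖)
      simp only [norm_mul (c n)]
      rw [integral_const_mul]
      gcongr
      exact hc n
    have h2 := hasSum_integral_of_summable_integral_norm hi hsum
    have h3 : ∫ w : Circle, ∑' n, c n * (g n w * f w) ∂circleMeasure = pairL hGL.toLp f := by
      rw [pairL_apply]
      refine integral_congr_ae ?_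
      filter_upwards [hGL.coeFn_toLp] with w hw
      rw [hw, hG, ← tsum_mul_right]
      simp only [mul_assoc]
    rw [h3] at h2
    refine h2.unique ((hasSum_pairEll c (S f)).congr_fun fun n => ?_)
    rw [hS, (hg n).pairL_toLp, integral_const_mul]

end

/-! ### Weak* convergence in `H^∞` -/

theorem hasSum_weakStarLInf {F : ℕ → LInf} {h : LInf}
    (H : ∀ f, HasSum (fun n => pairL (F n) f) (pairL h f)) :
    @HasSum LInf ℕ _ weakStarLInf F h (SummationFilter.unconditional ℕ) := by
  refine (WeakBilin.tendsto_iff_forall_eval_tendsto (B := pairL) pairL_injective).2 fun f => ?_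
  refine Filter.Tendsto.congr (fun s => ?_) (H f)
  exact ((map_sum pairL F s ▸ LinearMap.sum_apply s (fun n => pairL (F n)) f :
    pairL (∑ n ∈ s, F n) f = _)).symm

theorem mem_HInf_of_hasSum {F : ℕ → HInf} {h : LInf}
    (H : @HasSum LInf ℕ _ weakStarLInf (fun n => (F n : LInf)) h
      (SummationFilter.unconditional ℕ)) : h ∈ HInf := by
  let := weakStarLInf
  have hcl : @IsClosed LInf weakStarLInf (HInf : Set LInf) := by
    rw [coe_HInf]
    exact @isClosed_closure LInf weakStarLInf _
  exact hcl.mem_of_tendsto H (.of_forall fun s => Submodule.sum_mem _ fun n _ => (F n).2)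

theorem hasSum_weakStarHInf {F : ℕ → HInf} {h : HInf}
    (H : @HasSum LInf ℕ _ weakStarLInf (fun n => (F n : LInf)) (h : LInf)
      (SummationFilter.unconditional ℕ)) :
    @HasSum HInf ℕ _ weakStarHInf F h (SummationFilter.unconditional ℕ) := by
  let := weakStarLInf
  unfold HasSum
  rw [nhds_induced, Filter.tendsto_comap_iff]
  refine Filter.Tendsto.congr (fun s => ?_) H
  simp

theorem t2Space_weakStarHInf : @T2Space HInf weakStarHInf := by
  let := weakStarLInf
  have h1 : @T2Space LInf weakStarLInf :=
    (WeakBilin.isEmbedding (B := pairL) pairL_injective).t2Space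
  exact @Topology.IsEmbedding.t2Space _ _ weakStarHInf weakStarLInf _ _
    (@Topology.IsEmbedding.mk _ _ weakStarHInf weakStarLInf _ ⟨rfl⟩ Subtype.val_injective)

/-! ### Estimates from the arcs and the peaks -/

section

variable {Γ : ℕ → Set Circle} {a : ℕ → Circle} {δ : ℕ → ℝ} {g : ℕ → ℂ → ℂ}

/-- At most one index has `w` in its arc; it contributes at most `1`, every other index less than `δ
n`. -/
theorem sum_norm_le_one_add (hdisj : ∀ j k, j ≠ k → Disjoint (Γ j) (Γ k)) (hδ : ∀ n, 0 < δ n)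
    (hδs : Summable δ) (hg1 : ∀ n, ∀ w : Circle, ‖g n w‖ ≤ 1)
    (hgδ : ∀ n, ∀ w : Circle, w ∉ Γ n → ‖g n w‖ < δ n) (w : Circle) (s : Finset ℕ) :
    ∑ n ∈ s, ‖g n w‖ ≤ 1 + ∑' n, δ n := by
  have hs : ∑ n ∈ s, δ n ≤ ∑' n, δ n := hδs.sum_le_tsum s fun n _ => (hδ n).le
  by_cases hw : ∃ m, w ∈ Γ m
  · obtain ⟨m, hm⟩ := hw
    have hn : ∀ n, ‖g n w‖ ≤ (if n = m then 1 else 0) + δ n := fun n => by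
      split_ifs with h
      · linarith [hg1 n w, hδ n]
      · rw [zero_add]
        exact (hgδ n w fun hn => Set.disjoint_left.1 (hdisj n m h) hn hm).le
    refine (Finset.sum_le_sum fun n _ => hn n).trans ?_
    rw [Finset.sum_add_distrib, Finset.sum_ite_eq']
    split_ifs <;> linarith
  · push Not at hw
    linarith [Finset.sum_le_sum fun n (_ : n ∈ s) => (hgδ n w (hw n)).le]

/-- Near `a n`, inside `Γ n`, the function `g n` is `δ n`-close to `1` and each other `g k` is `δ
k`-close to `0`. Averaging preserves these bounds, and they add up in the `ℓ^1` norm. -/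
theorem exists_LOne_peak (hΓ : ∀ n, IsOpen (Γ n))
    (hdisj : ∀ j k, j ≠ k → Disjoint (Γ j) (Γ k)) (ha : ∀ n, a n ∈ Γ n)
    (hδ : ∀ n, 0 < δ n) (hδs : Summable δ)
    (hg : ∀ n, InDiskAlgebra (g n)) (hga : ∀ n, g n (a n) = 1)
    (hgδ : ∀ n, ∀ w : Circle, w ∉ Γ n → ‖g n w‖ < δ n)
    (S : LOne →L[ℂ] EllOne) (hS : ∀ f n, S f n = pairL (hg n).memLp.toLp f) (n : ℕ) :
    ∃ f : LOne, ‖f‖ = 1 ∧ ‖S f - lp.single 1 n 1‖ ≤ ∑' n, δ n := by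
  set U : Set Circle := Γ n ∩ {w | ‖g n w - 1‖ < δ n} with hUdef
  have hU : IsOpen U := (hΓ n).inter
    (isOpen_lt ((hg n).continuous_circle.sub continuous_const).norm continuous_const)
  have hU0 : circleMeasure U ≠ 0 :=
    (hU.measure_pos circleMeasure ⟨a n, ha n, by simpa [hga] using hδ n⟩).ne'
  obtain ⟨f, hf1, hf⟩ := exists_LOne_average hU.measurableSet hU0
  have hball : ∀ (k : ℕ) (z : ℂ), (∀ w ∈ U, ‖g k w - z‖ < δ k) → ‖S f k - z‖ ≤ δ k := by
    intro k z hz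
    rw [hS, hf _ _ (hg k).memLp.coeFn_toLp, ← mem_closedBall_iff_norm]
    -- An average of values in a closed convex set stays in that set.
    refine (convex_closedBall z (δ k)).set_average_mem Metric.isClosed_closedBall hU0
      (measure_ne_top _ _) ?_ ?_
    · filter_upwards [ae_restrict_mem hU.measurableSet] with w hw
      rw [mem_closedBall_iff_norm]
      exact (hz w hw).le
    · exact ((hg k).memLp.integrable le_top).integrableOn
  refine ⟨f, hf1, hasSum_le (fun k => ?_) (EllOne.hasSum_norm _) hδs.hasSum⟩
  rw [lp.coeFn_sub, Pi.sub_apply]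
  by_cases hk : k = n
  · subst hk
    rw [lp.single_apply_self]
    exact hball k 1 fun w hw => hw.2
  · rw [lp.single_apply_ne _ _ _ hk]
    refine hball k 0 fun w hw => ?_
    rw [sub_zero]
    exact hgδ k w fun hwk => Set.disjoint_left.1 (hdisj k n hk) hwk hw.1

end

/-! ### The theorem -/

theorem mainTheorem2
    (Γ : ℕ → Set Circle) (hΓ : ∀ n, IsOpenArc (Γ n))
    (hdisj : ∀ j k, j ≠ k → Disjoint (closure (Γ j)) (closure (Γ k)))
    (a : ℕ → Circle) (ha : ∀ n, a n ∈ Γ n)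
    (ε : ℝ) (δ : ℕ → ℝ) (hε : 0 < ε) (hε1 : ε < 1) (hδ : ∀ n, 0 < δ n)
    (hδs : Summable δ) (hδε : ∑' n, δ n < ε)
    (g : ℕ → ℂ → ℂ) (hg : ∀ n, InDiskAlgebra (g n))
    (hga : ∀ n, g n (a n) = 1)
    (hg1 : ∀ n, ∀ w : Circle, w ≠ a n → ‖g n w‖ < 1)
    (hgδ : ∀ n, ∀ w : Circle, w ∉ Γ n → ‖g n w‖ < δ n) :
    ∃ (E : Submodule ℂ HInf) (T : EllInf ≃L[ℂ] E),
      -- `T c = ∑ c_n g_n`, with weak*-convergence in `H^∞` and pointwise in the open disk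
      (∀ c : EllInf,
        @HasSum HInf ℕ _ weakStarHInf (fun n => c n • (hg n).toHInf) (T c : HInf)
          (SummationFilter.unconditional ℕ)) ∧
      (∀ c : EllInf, ∀ z ∈ Metric.ball (0 : ℂ) 1,
        HasSum (fun n => c n * g n z) (HInf.eval (T c) z)) ∧
      IsClosed[weakStarHInf] (E : Set HInf) ∧
      @IsHomeomorph EllInf E weakStarEllInf (weakStarSub E) T ∧
      ‖(T : EllInf →L[ℂ] E)‖ ≤ 1 + ε ∧
      ‖(T.symm : E →L[ℂ] EllInf)‖ ≤ (1 - ε)⁻¹ := by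
  have hdisj' : ∀ j k, j ≠ k → Disjoint (Γ j) (Γ k) := fun j k h =>
    (hdisj j k h).mono subset_closure subset_closure
  have hg1' : ∀ n, ∀ w : Circle, ‖g n w‖ ≤ 1 := fun n w => by
    by_cases hw : w = a n
    · rw [hw, hga, norm_one]
    · exact (hg1 n w hw).le
  have hε' : 0 < 1 - ε := by linarith
  have hB : ∀ (w : Circle) (s : Finset ℕ), ∑ n ∈ s, ‖g n w‖ ≤ 1 + ε := fun w s =>
    (sum_norm_le_one_add hdisj' hδ hδs hg1' hgδ w s).trans (by linarith)
  -- the preadjoint of `T` and a right inverse of it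
  obtain ⟨S, hS⟩ := exists_analysis hg hB
  choose v hv1 hv using exists_LOne_peak (fun n => (hΓ n).isOpen) hdisj' ha hδ hδs hg hga hgδ S hS
  obtain ⟨R, hR⟩ := EllOne.exists_map_single_eq v fun n => (hv1 n).le
  obtain ⟨Q, hQ, hQn⟩ := EllOne.exists_rightInverse (S ∘L R) hε.le hε1 fun n => by
    rw [ContinuousLinearMap.comp_apply, hR]
    exact (hv n).trans hδε.le
  have hSP : ∀ x, S (R (Q x)) = x := hQ
  have hPn : ∀ x, ‖R (Q x)‖ ≤ (1 - ε)⁻¹ * ‖x‖ := fun x =>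
    (EllOne.norm_map_le R (fun n => by rw [hR, hv1]) (Q x)).trans (by rw [one_mul]; exact hQn x)
  -- the operator `T` and its left inverse, with values in `L^∞` and `ℓ^∞`
  choose t htn ht using exists_synthesis hg (by linarith) hB S hS
  have htsum : ∀ c : EllInf, @HasSum LInf ℕ _ weakStarLInf
      (fun n => ((c n • (hg n).toHInf : HInf) : LInf)) (t c)
      (SummationFilter.unconditional ℕ) := fun c => hasSum_weakStarLInf fun f => by
    rw [ht]
    refine (hasSum_pairEll c (S f)).congr_fun fun n => ?_
    rw [hS, Submodule.coe_smul, map_smul, LinearMap.smul_apply, smul_eq_mul]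
    rfl
  -- The adjoint of `R Q`, defined on all of `L^∞`.
  have hadj : ∀ h : LInf, ∃ c : EllInf,
      (∀ x, pairEll c x = pairL h (R (Q x))) ∧ ‖c‖ ≤ (1 - ε)⁻¹ * ‖h‖ := fun h => by
    have hb : ∀ x : EllOne, ‖pairL h (R (Q x))‖ ≤ ((1 - ε)⁻¹ * ‖h‖) * ‖x‖ := fun x =>
      calc _ ≤ ‖h‖ * ‖R (Q x)‖ := norm_pairL_le _ _
        _ ≤ ‖h‖ * ((1 - ε)⁻¹ * ‖x‖) := by gcongr; exact hPn x
        _ = _ := by ring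
    obtain ⟨c, hc, hcn⟩ := EllInf.exists_pairEll_eq
      ((pairL h ∘ₗ (R ∘L Q : EllOne →L[ℂ] LOne).toLinearMap).mkContinuous _ hb)
      (by positivity) hb
    exact ⟨c, hc, hcn⟩
  choose p hp hpn using hadj
  have hpinj : Function.Injective pairEll := pairEll_injective
  let T₀ : EllInf →L[ℂ] HInf := LinearMap.mkContinuous
    { toFun := fun c => ⟨t c, mem_HInf_of_hasSum (htsum c)⟩
      map_add' := fun c c' => Subtype.ext <| pairL_injective <| LinearMap.ext fun f => by
        simp [ht]
      map_smul' := fun z c => Subtype.ext <| pairL_injective <| LinearMap.ext fun f => by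
        simp [ht] } (1 + ε) htn
  let P₀ : LInf →L[ℂ] EllInf := LinearMap.mkContinuous
    { toFun := p
      map_add' := fun c c' => hpinj <| LinearMap.ext fun f => by simp [hp]
      map_smul' := fun z c => hpinj <| LinearMap.ext fun f => by simp [hp] } _ hpn
  -- This is the adjoint of `S R Q = 1`.
  have hPT : ∀ c, P₀ (T₀ c : LInf) = c := fun c => hpinj <| LinearMap.ext fun x => by
    change pairEll (p (t c)) x = _
    rw [hp, ht, hSP]
  obtain ⟨E, hE⟩ : ∃ E : Submodule ℂ HInf, E = LinearMap.range T₀.toLinearMap := ⟨_, rfl⟩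
  have hTE : ∀ c, T₀ c ∈ E := fun c => hE ▸ ⟨c, rfl⟩
  let T : EllInf ≃L[ℂ] E := ContinuousLinearEquiv.equivOfInverse
    (T₀.codRestrict E hTE) (P₀ ∘L HInf.subtypeL ∘L E.subtypeL) hPT (by
      subst hE
      rintro ⟨_, c, rfl⟩
      exact Subtype.ext (congrArg T₀ (hPT c)))
  have hsum : ∀ c : EllInf,
      @HasSum HInf ℕ _ weakStarHInf (fun n => c n • (hg n).toHInf) (T c : HInf)
          (SummationFilter.unconditional ℕ) := fun c => hasSum_weakStarHInf (htsum c)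
  have hTc : @Continuous EllInf HInf weakStarEllInf weakStarHInf T₀ := by
    refine continuous_induced_rng.2 ?_
    refine @WeakBilin.continuous_of_continuous_eval _ _ _ _ _ _ _ _ _ _ pairL weakStarEllInf _
      fun f => ?_
    have h := WeakBilin.eval_continuous pairEll (S f)
    refine h.congr fun c => (ht c f).symm
  have hPc : @Continuous HInf EllInf weakStarHInf weakStarEllInf fun h => P₀ (h : LInf) := by
    refine @WeakBilin.continuous_of_continuous_eval _ _ _ _ _ _ _ _ _ _ pairEll weakStarHInf _
      fun x => ?_
    have h := @Continuous.comp _ _ _ weakStarHInf weakStarLInf _ _ _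
      (WeakBilin.eval_continuous pairL (R (Q x))) continuous_induced_dom
    exact @Continuous.congr _ _ weakStarHInf _ _ _ h fun c => (hp c x).symm
  refine ⟨E, T, hsum, fun c z hz => ?_, ?_, ?_, ?_, ?_⟩
  · obtain ⟨q, hq, hqg⟩ := exists_pairL_eq_eval hz
    rw [hq]
    change HasSum _ (pairL (t c) q)
    rw [ht]
    refine (hasSum_pairEll c (S q)).congr_fun fun n => ?_
    rw [hS, ← hqg _ (hg n)]
    rfl
  · rw [hE]
    -- The range is the set where `T₀ P₀ h = h`, closed because both sides are weak*-continuous and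
    -- the topology is Hausdorff.
    exact @Function.LeftInverse.isClosed_range _ _ weakStarHInf weakStarEllInf
      t2Space_weakStarHInf (fun h => P₀ (h : LInf)) T₀ hPT hPc hTc
  · refine (@isHomeomorph_iff_exists_inverse _ _ weakStarEllInf (weakStarSub E) _).2
      ⟨?_, T.symm, T.symm_apply_apply, T.apply_symm_apply, ?_⟩
    · exact continuous_induced_rng.2 hTc
    · exact @Continuous.comp _ _ _ (weakStarSub E) weakStarHInf weakStarEllInf _ _ hPc
        continuous_induced_dom
  · exact @ContinuousLinearMap.opNorm_le_bound _ _ _ _ _ _ _ _ _ (Submodule.normedSpace E) _ _ _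
      (by linarith) htn
  · exact @ContinuousLinearMap.opNorm_le_bound _ _ _ _ _ _ _ _ (Submodule.normedSpace E) _ _ _ _
      (by positivity) fun h => hpn _
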